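/- Let $k$ be a positive integer and let $\omega(n)=\sum_{p\mid n}1$ denote the number of distinct prime factors of $n$. Then the product over all primes $p$ below converges, and, as the real variables $x$ and $y$ tend to infinity independently of each other, \[ \lim_{x,y\to\infty}\frac{1}{xy(\log x\,\log y)^{k-1}}\sum_{n_1\le x}\;\sum_{n_2\le y}k^{\omega(n_1n_2)} =\frac{1}{((k-1)!)^2}\prod_{p}\Bigl(1-\frac1p\Bigr)^{2(k-1)}\Bigl(1+\frac{2(k-1)}{p}+\frac{1-k}{p^2}\Bigr), \] where $n_1,n_2$ run over positive integers. -/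

import Mathlib

open Filter Topology

open scoped ArithmeticFunction.zeta ArithmeticFunction.Moebius

/-! Write `k = m + 1`. Since ω(ab) = ω(a) + ω(b) − ω(gcd(a, b)), expanding k^(−ω(gcd)) as a divisor
sum of `gcdWeight` separates the variables: the double sum becomes ∑_d `gcdWeight m d` · M_d(x)
M_d(y), where M_d is `multiplesSum`, a one-variable sum over multiples of d (`sum_sum_pow_eq_tsum`).
Each M_d has a mean value on the scale x (log x)^m. It comes from writing a multiplicative f with
f(p) near m + 1 as g * ζ^(m+1), where ∑ |g(n)|/n converges, and using the elementary asymptotics of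
ζ^(m+1) (`exists_hasProd_tendsto_partialSum`). The normalized M_d are bounded by (m+1)^ω(d)/d up to
a constant independent of d, so dominated convergence passes to the limit in x and y independently
(`tendsto_tsum_gcdWeight`). The limiting series is an Euler product, identified prime by prime in
`hasProd_sq_mul_tsum_gcdWeight`. -/

/-- The partial sum of an arithmetic function over the positive integers up to `x`. -/
noncomputable def partialSum (f : ArithmeticFunction ℝ) (x : ℝ) : ℝ :=
  ∑ n ∈ Finset.Ioc 0 ⌊x⌋₊, f n

lemma partialSum_mul (f g : ArithmeticFunction ℝ) (x : ℝ) :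
    partialSum (f * g) x = ∑ n ∈ Finset.Ioc 0 ⌊x⌋₊, f n * partialSum g (x / n) := by
  simp only [partialSum, ArithmeticFunction.sum_Ioc_mul_eq_sum_sum, Nat.floor_div_natCast]

lemma partialSum_of_lt_one (f : ArithmeticFunction ℝ) {x : ℝ} (hx : x < 1) :
    partialSum f x = 0 := by
  simp [partialSum, Nat.floor_eq_zero.2 hx]

lemma one_le_div_of_mem_Ioc_floor {x : ℝ} {n : ℕ} (hn : n ∈ Finset.Ioc 0 ⌊x⌋₊) :
    1 ≤ x / n := by
  obtain ⟨h0, h1⟩ := Finset.mem_Ioc.1 hn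
  have h0' : (0 : ℝ) < n := by exact_mod_cast h0
  rw [one_le_div h0']
  exact (Nat.le_floor_iff' h0.ne').1 h1

/-! ### Sums of log(x/n)^j / n -/

lemma pow_succ_sub_pow_succ_le {a b : ℝ} (hb : 0 ≤ b) (hab : b ≤ a) (j : ℕ) :
    a ^ (j + 1) - b ^ (j + 1) ≤ (j + 1) * (a ^ j * (a - b)) := by
  induction j with
  | zero => simp
  | succ j ih =>
    have h1 : b ^ (j + 1) * (a - b) ≤ a ^ (j + 1) * (a - b) :=
      mul_le_mul_of_nonneg_right (pow_le_pow_left₀ hb hab _) (sub_nonneg.2 hab)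
    have h2 := mul_le_mul_of_nonneg_left ih (hb.trans hab)
    push_cast
    calc a ^ (j + 1 + 1) - b ^ (j + 1 + 1)
        = a * (a ^ (j + 1) - b ^ (j + 1)) + b ^ (j + 1) * (a - b) := by ring
      _ ≤ a * ((j + 1) * (a ^ j * (a - b))) + a ^ (j + 1) * (a - b) := add_le_add h2 h1
      _ = _ := by ring

lemma le_pow_succ_sub_pow_succ {a b : ℝ} (hb : 0 ≤ b) (hab : b ≤ a) (j : ℕ) :
    (j + 1) * (b ^ j * (a - b)) ≤ a ^ (j + 1) - b ^ (j + 1) := by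
  induction j with
  | zero => simp
  | succ j ih =>
    have h2 := mul_le_mul_of_nonneg_left ih hb
    have h3 : b ^ (j + 1) * (a - b) ≤ a ^ (j + 1) * (a - b) :=
      mul_le_mul_of_nonneg_right (pow_le_pow_left₀ hb hab _) (sub_nonneg.2 hab)
    push_cast
    calc ((j : ℝ) + 1 + 1) * (b ^ (j + 1) * (a - b))
        = b * ((j + 1) * (b ^ j * (a - b))) + b ^ (j + 1) * (a - b) := by ring
      _ ≤ b * (a ^ (j + 1) - b ^ (j + 1)) + a ^ (j + 1) * (a - b) := add_le_add h2 h3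
      _ = _ := by ring

lemma log_sub_log_succ_bounds {x : ℝ} (hx : 0 < x) {n : ℕ} (hn : 0 < n) :
    Real.log (x / n) - Real.log (x / (n + 1 : ℕ)) ≤ 1 / n ∧
      1 / ((n + 1 : ℕ) : ℝ) ≤ Real.log (x / n) - Real.log (x / (n + 1 : ℕ)) := by
  have h0 : (0 : ℝ) < n := by exact_mod_cast hn
  have h1 : (0 : ℝ) < (n + 1 : ℕ) := by positivity
  have e : Real.log (x / n) - Real.log (x / (n + 1 : ℕ)) = Real.log ((n + 1 : ℕ) / n) := by
    rw [Real.log_div hx.ne' h0.ne', Real.log_div hx.ne' h1.ne', Real.log_div h1.ne' h0.ne']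
    ring
  rw [e]
  constructor
  · refine (Real.log_le_sub_one_of_pos (by positivity)).trans (le_of_eq ?_)
    push_cast
    field_simp
    ring
  · refine le_trans (le_of_eq ?_) (Real.one_sub_inv_le_log_of_pos (by positivity))
    push_cast
    field_simp
    ring

lemma sum_log_pow_div_bounds_nat (j : ℕ) {x : ℝ} (hx : 1 ≤ x) {N : ℕ} (hN : 1 ≤ N)
    (hNx : (N : ℝ) ≤ x) :
    Real.log x ^ (j + 1) - Real.log (x / N) ^ (j + 1) ≤
        (j + 1) * ∑ n ∈ Finset.Ioc 0 N, Real.log (x / n) ^ j / n ∧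
      (j + 1) * ∑ n ∈ Finset.Ioc 0 N, Real.log (x / n) ^ j / n ≤
        Real.log x ^ (j + 1) - Real.log (x / N) ^ (j + 1) + (j + 1) * Real.log x ^ j := by
  have hx0 : 0 < x := by linarith
  -- The increment from N to N + 1 is bounded above by the term at N and below by the term at N + 1.
  -- The lower bound therefore inducts cleanly only with the last term left out.
  suffices H : Real.log x ^ (j + 1) - Real.log (x / N) ^ (j + 1) ≤
        (j + 1) * (∑ n ∈ Finset.Ioc 0 N, Real.log (x / n) ^ j / n - Real.log (x / N) ^ j / N) ∧
      (j + 1) * ∑ n ∈ Finset.Ioc 0 N, Real.log (x / n) ^ j / n ≤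
        Real.log x ^ (j + 1) - Real.log (x / N) ^ (j + 1) + (j + 1) * Real.log x ^ j by
    refine ⟨H.1.trans ?_, H.2⟩
    have hN0 : (0 : ℝ) < N := by exact_mod_cast hN
    have : 0 ≤ Real.log (x / N) ^ j / N :=
      div_nonneg (pow_nonneg (Real.log_nonneg ((one_le_div hN0).2 hNx)) _) hN0.le
    exact mul_le_mul_of_nonneg_left (by linarith) (by positivity)
  induction N, hN using Nat.le_induction with
  | base => simp
  | succ N hN ih =>
    have hN0 : (0 : ℝ) < N := by exact_mod_cast hN
    obtain ⟨ih1, ih2⟩ := ih (le_trans (by push_cast; linarith) hNx)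
    obtain ⟨l1, l2⟩ := log_sub_log_succ_bounds hx0 (n := N) hN
    rw [Finset.sum_Ioc_succ_top (Nat.zero_le N)]
    have hb : 0 ≤ Real.log (x / (N + 1 : ℕ)) :=
      Real.log_nonneg ((one_le_div (by positivity)).2 hNx)
    have hab : Real.log (x / (N + 1 : ℕ)) ≤ Real.log (x / N) := by
      have : 0 ≤ 1 / ((N + 1 : ℕ) : ℝ) := by positivity
      linarith
    set a := Real.log (x / N)
    set b := Real.log (x / (N + 1 : ℕ))
    have u := pow_succ_sub_pow_succ_le hb hab j
    have v := le_pow_succ_sub_pow_succ hb hab j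
    have u' : a ^ j * (a - b) ≤ a ^ j / N := by
      rw [div_eq_mul_one_div]
      exact mul_le_mul_of_nonneg_left l1 (pow_nonneg (hb.trans hab) _)
    have v' : b ^ j / (N + 1 : ℕ) ≤ b ^ j * (a - b) := by
      rw [div_eq_mul_one_div]
      exact mul_le_mul_of_nonneg_left l2 (pow_nonneg hb _)
    have hj : (0 : ℝ) ≤ j + 1 := by positivity
    have u'' := mul_le_mul_of_nonneg_left u' hj
    have v'' := mul_le_mul_of_nonneg_left v' hj
    constructor <;> linarith

lemma abs_sum_log_pow_div_sub_le (j : ℕ) {x : ℝ} (hx : 1 ≤ x) :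
    |∑ n ∈ Finset.Ioc 0 ⌊x⌋₊, Real.log (x / n) ^ j / n - Real.log x ^ (j + 1) / (j + 1)| ≤
      1 + Real.log x ^ j := by
  have hN : 1 ≤ ⌊x⌋₊ := Nat.one_le_floor_iff x |>.2 hx
  have hNx : (⌊x⌋₊ : ℝ) ≤ x := Nat.floor_le (by linarith)
  have hN0 : (0 : ℝ) < ⌊x⌋₊ := by exact_mod_cast hN
  have hN1 : (1 : ℝ) ≤ ⌊x⌋₊ := by exact_mod_cast hN
  obtain ⟨h1, h2⟩ := sum_log_pow_div_bounds_nat j hx hN hNx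
  have hl0 : 0 ≤ Real.log (x / ⌊x⌋₊) := Real.log_nonneg ((one_le_div hN0).2 hNx)
  have hl1 : Real.log (x / ⌊x⌋₊) ≤ 1 := by
    refine (Real.log_le_sub_one_of_pos (by positivity)).trans ?_
    rw [sub_le_iff_le_add, div_le_iff₀ hN0]
    linarith [Nat.lt_floor_add_one x]
  have p0 := pow_nonneg hl0 (j + 1)
  have p1 := pow_le_one₀ hl0 hl1 (n := j + 1)
  have hL := pow_nonneg (Real.log_nonneg hx) j
  have hj : (0 : ℝ) < j + 1 := by positivity
  have hj1 : (1 : ℝ) ≤ j + 1 := by linarith [Nat.cast_nonneg (α := ℝ) j]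
  set S := ∑ n ∈ Finset.Ioc 0 ⌊x⌋₊, Real.log (x / n) ^ j / n
  have e : S - Real.log x ^ (j + 1) / (j + 1) =
      ((j + 1) * S - Real.log x ^ (j + 1)) / (j + 1) := by field_simp
  rw [e, abs_div, abs_of_pos hj, div_le_iff₀ hj, abs_le]
  constructor <;> nlinarith

lemma sum_one_div_le {x : ℝ} (hx : 1 ≤ x) :
    ∑ n ∈ Finset.Ioc 0 ⌊x⌋₊, 1 / (n : ℝ) ≤ 2 * (1 + Real.log x) := by
  have h := (abs_le.1 (abs_sum_log_pow_div_sub_le 0 hx)).2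
  simp only [pow_zero, zero_add, pow_one, CharP.cast_eq_zero, div_one] at h
  linarith [Real.log_nonneg hx]

/-- This is one convolution with ζ: the main term gains a factor log x / (j + 1), and the old error
is summed over x/n. -/
lemma abs_sum_div_sub_le {P e : ℝ → ℝ} (j : ℕ)
    (h : ∀ u, 1 ≤ u → |P u - u * Real.log u ^ j / j.factorial| ≤ e u) {x : ℝ} (hx : 1 ≤ x) :
    |∑ n ∈ Finset.Ioc 0 ⌊x⌋₊, P (x / n) - x * Real.log x ^ (j + 1) / (j + 1).factorial| ≤
      ∑ n ∈ Finset.Ioc 0 ⌊x⌋₊, e (x / n) + x * (1 + Real.log x ^ j) := by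
  have hf : (1 : ℝ) ≤ j.factorial := by exact_mod_cast Nat.factorial_pos j
  have e1 : ∑ n ∈ Finset.Ioc 0 ⌊x⌋₊, P (x / n) - x * Real.log x ^ (j + 1) / (j + 1).factorial =
      ∑ n ∈ Finset.Ioc 0 ⌊x⌋₊, (P (x / n) - x / n * Real.log (x / n) ^ j / j.factorial) +
      x / j.factorial * (∑ n ∈ Finset.Ioc 0 ⌊x⌋₊, Real.log (x / n) ^ j / n -
        Real.log x ^ (j + 1) / (j + 1)) := by
    rw [Finset.sum_sub_distrib, mul_sub, Finset.mul_sum, Nat.factorial_succ]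
    have : ∀ n ∈ Finset.Ioc 0 ⌊x⌋₊, x / n * Real.log (x / n) ^ j / j.factorial =
      x / j.factorial * (Real.log (x / n) ^ j / n) := fun n _ => by ring
    rw [Finset.sum_congr rfl this]
    push_cast
    field_simp
    ring
  rw [e1]
  refine (abs_add_le _ _).trans (add_le_add ?_ ?_)
  · exact (Finset.abs_sum_le_sum_abs _ _).trans
      (Finset.sum_le_sum fun n hn => h _ (one_le_div_of_mem_Ioc_floor hn))
  · rw [abs_mul, abs_of_nonneg (by positivity)]
    exact mul_le_mul (div_le_self (by linarith) hf) (abs_sum_log_pow_div_sub_le j hx)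
      (abs_nonneg _) (by linarith)

/-! ### Summatory functions of powers of ζ -/

lemma partialSum_zeta (x : ℝ) : partialSum (ζ : ArithmeticFunction ℝ) x = ⌊x⌋₊ := by
  have := ArithmeticFunction.sum_Ioc_zeta ⌊x⌋₊
  simp only [partialSum, ArithmeticFunction.natCoe_apply]
  exact_mod_cast this

lemma partialSum_zeta_pow_succ (j : ℕ) (x : ℝ) :
    partialSum ((ζ : ArithmeticFunction ℝ) ^ (j + 1)) x =
      ∑ n ∈ Finset.Ioc 0 ⌊x⌋₊, partialSum ((ζ : ArithmeticFunction ℝ) ^ j) (x / n) := by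
  rw [pow_succ', partialSum_mul]
  refine Finset.sum_congr rfl fun n hn => ?_
  rw [ArithmeticFunction.natCoe_apply,
    ArithmeticFunction.zeta_apply_ne (Finset.mem_Ioc.1 hn).1.ne', Nat.cast_one, one_mul]

/-- Induction by convolving with ζ; summing the error over x/n costs one logarithm, as ∑ 1/n does.
The start is ζ², the first power whose error has a nonnegative log exponent in this form. -/
theorem exists_abs_partialSum_zeta_pow_sub_le (j : ℕ) :
    ∃ C : ℝ, 0 ≤ C ∧ ∀ x : ℝ, 1 ≤ x →
      |partialSum ((ζ : ArithmeticFunction ℝ) ^ (j + 2)) x -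
        x * Real.log x ^ (j + 1) / (j + 1).factorial| ≤ C * (x * (1 + Real.log x) ^ j) := by
  induction j with
  | zero =>
    -- The floor errors total at most x, and the comparison with the logarithm adds 2x.
    refine ⟨3, by norm_num, fun x hx => ?_⟩
    rw [partialSum_zeta_pow_succ]
    refine (abs_sum_div_sub_le (e := fun _ => 1) 0 (fun u hu => ?_) hx).trans ?_
    · rw [pow_one, partialSum_zeta, abs_le]
      have := Nat.lt_floor_add_one u
      have := Nat.floor_le (a := u) (by linarith)
      constructor <;> simp <;> linarith
    · have := Nat.floor_le (a := x) (by linarith)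
      simp
      linarith
  | succ j ih =>
    obtain ⟨C, hC, h⟩ := ih
    refine ⟨2 * C + 2, by positivity, fun x hx => ?_⟩
    have hl := Real.log_nonneg hx
    rw [partialSum_zeta_pow_succ]
    refine (abs_sum_div_sub_le (j + 1) h hx).trans ?_
    have h1 : ∑ n ∈ Finset.Ioc 0 ⌊x⌋₊, C * (x / n * (1 + Real.log (x / n)) ^ j) ≤
        C * x * (1 + Real.log x) ^ j * ∑ n ∈ Finset.Ioc 0 ⌊x⌋₊, 1 / (n : ℝ) := by
      rw [Finset.mul_sum]
      refine Finset.sum_le_sum fun n hn => ?_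
      have hn1 : (1 : ℝ) ≤ n := by exact_mod_cast (Finset.mem_Ioc.1 hn).1
      have hu := one_le_div_of_mem_Ioc_floor hn
      have : (1 + Real.log (x / n)) ^ j ≤ (1 + Real.log x) ^ j := by
        have := Real.log_nonneg hu
        have := Real.log_le_log (by linarith) (div_le_self (by linarith : 0 ≤ x) hn1)
        gcongr
      calc C * (x / n * (1 + Real.log (x / n)) ^ j)
          ≤ C * (x / n * (1 + Real.log x) ^ j) := by gcongr
        _ = _ := by ring
    have h2 : C * x * (1 + Real.log x) ^ j * ∑ n ∈ Finset.Ioc 0 ⌊x⌋₊, 1 / (n : ℝ) ≤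
        C * x * (1 + Real.log x) ^ j * (2 * (1 + Real.log x)) :=
      mul_le_mul_of_nonneg_left (sum_one_div_le hx) (by positivity)
    have h3 : x * (1 + Real.log x ^ (j + 1)) ≤ x * (2 * (1 + Real.log x) ^ (j + 1)) := by
      have a1 : (1 : ℝ) ≤ (1 + Real.log x) ^ (j + 1) := one_le_pow₀ (by linarith)
      have a2 : Real.log x ^ (j + 1) ≤ (1 + Real.log x) ^ (j + 1) := by gcongr; linarith
      gcongr
      linarith
    calc _ ≤ _ := add_le_add (h1.trans h2) h3
      _ = _ := by ring

theorem exists_abs_partialSum_zeta_pow_le (j : ℕ) :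
    ∃ C : ℝ, 0 ≤ C ∧ ∀ x : ℝ, 1 ≤ x →
      |partialSum ((ζ : ArithmeticFunction ℝ) ^ (j + 1)) x| ≤ C * (x * (1 + Real.log x) ^ j) := by
  cases j with
  | zero =>
    refine ⟨1, by norm_num, fun x hx => ?_⟩
    rw [zero_add, pow_one, partialSum_zeta, abs_of_nonneg (by positivity)]
    simpa using Nat.floor_le (a := x) (by linarith)
  | succ j =>
    obtain ⟨C, hC, h⟩ := exists_abs_partialSum_zeta_pow_sub_le j
    refine ⟨C + 1, by positivity, fun x hx => ?_⟩
    have hl := Real.log_nonneg hx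
    have hf : (1 : ℝ) ≤ (j + 1).factorial := by exact_mod_cast Nat.factorial_pos (j + 1)
    have h1 : |x * Real.log x ^ (j + 1) / (j + 1).factorial| ≤ x * (1 + Real.log x) ^ (j + 1) := by
      rw [abs_of_nonneg (by positivity)]
      refine (div_le_self (by positivity) hf).trans ?_
      gcongr
      linarith
    have h2 : C * (x * (1 + Real.log x) ^ j) ≤ C * (x * (1 + Real.log x) ^ (j + 1)) := by
      gcongr
      · linarith
      · omega
    have h3 := abs_sub_abs_le_abs_sub (partialSum ((ζ : ArithmeticFunction ℝ) ^ (j + 2)) x)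
      (x * Real.log x ^ (j + 1) / (j + 1).factorial)
    have h4 := h x hx
    show |partialSum ((ζ : ArithmeticFunction ℝ) ^ (j + 2)) x| ≤ _
    linarith

theorem tendsto_partialSum_zeta_pow (j : ℕ) :
    Tendsto (fun x : ℝ => partialSum ((ζ : ArithmeticFunction ℝ) ^ (j + 1)) x /
      (x * Real.log x ^ j)) atTop (𝓝 (1 / j.factorial)) := by
  cases j with
  | zero =>
    simpa [partialSum_zeta] using tendsto_nat_floor_div_atTop (R := ℝ)
  | succ j =>
    obtain ⟨C, hC, h⟩ := exists_abs_partialSum_zeta_pow_sub_le j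
    rw [tendsto_iff_norm_sub_tendsto_zero]
    have lim : Tendsto (fun x : ℝ => C * 2 ^ j / Real.log x) atTop (𝓝 0) :=
      tendsto_const_nhds.div_atTop Real.tendsto_log_atTop
    refine squeeze_zero' (Eventually.of_forall fun _ => norm_nonneg _) ?_ lim
    filter_upwards [eventually_ge_atTop (1 : ℝ),
      Real.tendsto_log_atTop.eventually_ge_atTop 1] with x hx hl
    have hf : (0 : ℝ) < (j + 1).factorial := by positivity
    have hl0 : 0 < Real.log x := by linarith
    have e : partialSum ((ζ : ArithmeticFunction ℝ) ^ (j + 1 + 1)) x /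
        (x * Real.log x ^ (j + 1)) - 1 / (j + 1).factorial =
        (partialSum ((ζ : ArithmeticFunction ℝ) ^ (j + 2)) x -
        x * Real.log x ^ (j + 1) / (j + 1).factorial) / (x * Real.log x ^ (j + 1)) := by
      field_simp
    rw [e, Real.norm_eq_abs, abs_div, abs_of_pos (a := x * Real.log x ^ (j + 1)) (by positivity),
      div_le_div_iff₀ (by positivity) hl0]
    calc _ ≤ C * (x * (1 + Real.log x) ^ j) * Real.log x := by gcongr; exact h x hx
      _ ≤ C * (x * (2 * Real.log x) ^ j) * Real.log x := by gcongr; linarith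
      _ = _ := by ring

/-! ### Convolution with g when ∑ |g(n)|/n converges -/

/-- Partial sums vanish below 1, so the range of summation need not depend on x; this makes
dominated convergence applicable. -/
lemma partialSum_mul_eq_tsum (g f : ArithmeticFunction ℝ) (x : ℝ) :
    partialSum (g * f) x = ∑' n : ℕ, g n * partialSum f (x / n) := by
  rw [partialSum_mul, tsum_eq_sum]
  intro n hn
  rcases Nat.eq_zero_or_pos n with rfl | h0
  · simp
  · have h : ⌊x⌋₊ < n := by
      by_contra h
      exact hn (Finset.mem_Ioc.2 ⟨h0, not_lt.1 h⟩)
    have : x / n < 1 := (div_lt_one (by exact_mod_cast h0)).2 ((Nat.floor_lt' h0.ne').1 h)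
    rw [partialSum_of_lt_one _ this, mul_zero]

/-- A growth bound for the partial sums at `x` passes to those at `x / n`. -/
lemma abs_partialSum_div_le {f : ArithmeticFunction ℝ} {C : ℝ} (hC : 0 ≤ C) {j : ℕ}
    (h : ∀ x : ℝ, 1 ≤ x → |partialSum f x| ≤ C * (x * (1 + Real.log x) ^ j))
    {x : ℝ} (hx : 1 ≤ x) (n : ℕ) :
    |partialSum f (x / n)| ≤ C * (x / n * (1 + Real.log x) ^ j) := by
  have hl := Real.log_nonneg hx
  by_cases hn : x / n < 1
  · rw [partialSum_of_lt_one _ hn, abs_zero]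
    positivity
  · rw [not_lt] at hn
    have hn1 : (1 : ℝ) ≤ n := by
      rcases Nat.eq_zero_or_pos n with rfl | h0
      · norm_num at hn
      · exact_mod_cast h0
    refine (h _ hn).trans ?_
    have := Real.log_nonneg hn
    have := Real.log_le_log (by linarith) (div_le_self (by linarith : 0 ≤ x) hn1)
    gcongr

lemma exists_abs_partialSum_mul_zeta_pow_le (j : ℕ) {g : ArithmeticFunction ℝ}
    (hg : Summable fun n : ℕ => ‖g n / n‖) :
    ∃ C : ℝ, 0 ≤ C ∧ ∀ x : ℝ, 1 ≤ x →
      |partialSum (g * (ζ : ArithmeticFunction ℝ) ^ (j + 1)) x| ≤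
        C * (x * (1 + Real.log x) ^ j) := by
  obtain ⟨C, hC, h⟩ := exists_abs_partialSum_zeta_pow_le j
  refine ⟨(∑' n : ℕ, ‖g n / n‖) * C, mul_nonneg (tsum_nonneg fun _ => norm_nonneg _) hC,
    fun x hx => ?_⟩
  rw [partialSum_mul_eq_tsum, ← Real.norm_eq_abs, mul_assoc]
  refine tsum_of_norm_bounded (hg.hasSum.mul_right _) fun n => ?_
  rw [norm_mul, norm_div, Real.norm_natCast]
  calc _ ≤ ‖g n‖ * (C * (x / n * (1 + Real.log x) ^ j)) :=
        mul_le_mul_of_nonneg_left (abs_partialSum_div_le hC h hx n) (norm_nonneg _)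
    _ = _ := by ring

lemma tendsto_log_div_natCast_div_log {n : ℕ} (hn : 0 < n) :
    Tendsto (fun x : ℝ => Real.log (x / n) / Real.log x) atTop (𝓝 1) := by
  have h : Tendsto (fun x : ℝ => 1 - Real.log n / Real.log x) atTop (𝓝 (1 - 0)) :=
    tendsto_const_nhds.sub (tendsto_const_nhds.div_atTop Real.tendsto_log_atTop)
  rw [sub_zero] at h
  refine h.congr' ?_
  filter_upwards [eventually_gt_atTop (1 : ℝ)] with x hx
  have := Real.log_pos hx
  rw [Real.log_div (by positivity) (by positivity), sub_div, div_self this.ne']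

lemma tendsto_partialSum_div_natCast {f : ArithmeticFunction ℝ} {j : ℕ} {c : ℝ}
    (h : Tendsto (fun x : ℝ => partialSum f x / (x * Real.log x ^ j)) atTop (𝓝 c)) (n : ℕ) :
    Tendsto (fun x : ℝ => partialSum f (x / n) / (x * Real.log x ^ j)) atTop (𝓝 (c / n)) := by
  rcases Nat.eq_zero_or_pos n with rfl | hn
  · simp [partialSum]
  have hn' : (0 : ℝ) < n := by exact_mod_cast hn
  have h1 := h.comp (tendsto_id.atTop_div_const hn')
  have h2 := (h1.mul ((tendsto_log_div_natCast_div_log hn).pow j)).div_const (n : ℝ)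
  rw [one_pow, mul_one] at h2
  refine h2.congr' ?_
  filter_upwards [eventually_gt_atTop (n : ℝ)] with x hx
  have h3 : 0 < Real.log (x / n) := Real.log_pos ((one_lt_div hn').2 hx)
  simp only [Function.comp_apply, id_eq]
  rw [div_pow]
  field_simp

theorem tendsto_partialSum_mul_zeta_pow (j : ℕ) {g : ArithmeticFunction ℝ}
    (hg : Summable fun n : ℕ => ‖g n / n‖) :
    Tendsto (fun x : ℝ => partialSum (g * (ζ : ArithmeticFunction ℝ) ^ (j + 1)) x /
      (x * Real.log x ^ j)) atTop (𝓝 ((∑' n : ℕ, g n / n) / j.factorial)) := by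
  obtain ⟨C, hC, h⟩ := exists_abs_partialSum_zeta_pow_le j
  have key : Tendsto (fun x : ℝ => ∑' n : ℕ, g n *
      (partialSum ((ζ : ArithmeticFunction ℝ) ^ (j + 1)) (x / n) / (x * Real.log x ^ j)))
      atTop (𝓝 (∑' n : ℕ, g n * (1 / j.factorial / n))) := by
    refine tendsto_tsum_of_dominated_convergence (hg.mul_right (C * 2 ^ j))
      (fun n => (tendsto_partialSum_div_natCast (tendsto_partialSum_zeta_pow j) n).const_mul _) ?_
    filter_upwards [eventually_ge_atTop (1 : ℝ),
      Real.tendsto_log_atTop.eventually_ge_atTop 1] with x hx hl n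
    rw [norm_mul, norm_div, norm_div, Real.norm_natCast, Real.norm_of_nonneg
      (by positivity : 0 ≤ x * Real.log x ^ j), div_mul_eq_mul_div, mul_div_assoc]
    refine mul_le_mul_of_nonneg_left ?_ (norm_nonneg _)
    rw [div_le_iff₀ (by positivity)]
    calc _ ≤ C * (x / n * (1 + Real.log x) ^ j) := abs_partialSum_div_le hC h hx n
      _ ≤ C * (x / n * (2 * Real.log x) ^ j) := by gcongr; linarith
      _ = _ := by ring
  have e : (∑' n : ℕ, g n / n) / j.factorial = ∑' n : ℕ, g n * (1 / j.factorial / n) := by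
    rw [← tsum_div_const]
    exact tsum_congr fun n => by ring
  rw [e]
  refine key.congr fun x => ?_
  rw [partialSum_mul_eq_tsum, ← tsum_div_const]
  exact tsum_congr fun n => by ring

/-! ### Absolute summability of multiplicative functions -/

lemma hasSum_div_prime_pow_add_two (B : ℝ) {p : ℕ} (hp : p.Prime) :
    HasSum (fun e : ℕ => B / (p : ℝ) ^ (e + 2)) (B / (p : ℝ) ^ 2 * (1 - (p : ℝ)⁻¹)⁻¹) := by
  have hp1 : (1 : ℝ) < p := by exact_mod_cast hp.one_lt
  have h := (hasSum_geometric_of_lt_one (r := (p : ℝ)⁻¹) (by positivity)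
    (inv_lt_one_of_one_lt₀ hp1)).mul_left (B / (p : ℝ) ^ 2)
  refine (congrArg (HasSum · _) (funext fun e => ?_)).mpr h
  rw [inv_pow, pow_add]
  field_simp

lemma summable_norm_prime_pow {F : ℕ → ℝ} {B : ℝ} {p : ℕ} (hp : p.Prime)
    (h2 : ∀ e : ℕ, ‖F (p ^ (e + 2))‖ ≤ B / (p : ℝ) ^ (e + 2)) :
    Summable fun e : ℕ => ‖F (p ^ e)‖ :=
  (summable_nat_add_iff 2).1 <| Summable.of_nonneg_of_le (fun _ => norm_nonneg _) h2
    (hasSum_div_prime_pow_add_two B hp).summable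

/-- The 3 is 1 from the exponent one and 2 from the geometric tail, whose ratio is at most 1/2. -/
lemma tsum_norm_prime_pow_le {F : ℕ → ℝ} {B : ℝ} (hB : 0 ≤ B) {p : ℕ} (hp : p.Prime)
    (hF1 : F 1 = 1) (h1 : ‖F p‖ ≤ B / (p : ℝ) ^ 2)
    (h2 : ∀ e : ℕ, ‖F (p ^ (e + 2))‖ ≤ B / (p : ℝ) ^ (e + 2)) :
    ∑' e : ℕ, ‖F (p ^ e)‖ ≤ 1 + 3 * B / (p : ℝ) ^ 2 := by
  have hp2 : (2 : ℝ) ≤ p := by exact_mod_cast hp.two_le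
  have hs := summable_norm_prime_pow hp h2
  have hs' := (summable_nat_add_iff 2).2 hs
  have hg := hasSum_div_prime_pow_add_two B hp
  rw [← hs.sum_add_tsum_nat_add 2, Finset.sum_range_succ, Finset.sum_range_one, pow_zero, pow_one,
    hF1, norm_one]
  have h3 := hs'.tsum_le_tsum h2 hg.summable
  rw [hg.tsum_eq] at h3
  have h4 : (1 - (p : ℝ)⁻¹)⁻¹ ≤ 2 := by
    have : (p : ℝ)⁻¹ ≤ 2⁻¹ := inv_anti₀ (by norm_num) hp2
    exact inv_le_of_inv_le₀ (by norm_num) (by linarith)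
  have h5 := mul_le_mul_of_nonneg_left h4 (by positivity : 0 ≤ B / (p : ℝ) ^ 2)
  have h6 : 3 * B / (p : ℝ) ^ 2 = B / (p : ℝ) ^ 2 + B / (p : ℝ) ^ 2 * 2 := by ring
  linarith

/-- A multiplicative function with `F (p ^ e) = O(p ^ (-max e 2))`, uniformly in `p`, is absolutely
summable. -/
theorem summable_norm_of_multiplicative {F : ℕ → ℝ} {B : ℝ} (hB : 0 ≤ B) (hF0 : F 0 = 0)
    (hF1 : F 1 = 1) (hmul : ∀ {m n : ℕ}, m.Coprime n → F (m * n) = F m * F n)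
    (h1 : ∀ p : ℕ, p.Prime → ‖F p‖ ≤ B / (p : ℝ) ^ 2)
    (h2 : ∀ p : ℕ, p.Prime → ∀ e : ℕ, ‖F (p ^ (e + 2))‖ ≤ B / (p : ℝ) ^ (e + 2)) :
    Summable fun n => ‖F n‖ := by
  have hb : Summable fun n : ℕ => 3 * B / (n : ℝ) ^ 2 := by
    simpa [div_eq_mul_inv] using
      (Real.summable_one_div_nat_pow.2 one_lt_two).mul_left (3 * B)
  -- A finite sum is dominated by the sum over N-smooth numbers, a finite Euler product, and 1 + t ≤
  -- exp t bounds that product independently of N.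
  refine summable_of_sum_le (c := Real.exp (∑' n : ℕ, 3 * B / (n : ℝ) ^ 2))
    (fun _ => norm_nonneg _) fun u => ?_
  obtain ⟨N, hN⟩ : ∃ N, ∀ n ∈ u, n < N := ⟨u.sup id + 1, fun n hn =>
    Nat.lt_succ_of_le (Finset.le_sup (f := id) hn)⟩
  obtain ⟨hs, hsum⟩ := EulerProduct.summable_and_hasSum_smoothNumbers_prod_primesBelow_tsum
    (f := fun n => ‖F n‖) (by simp [hF1]) (fun h => by simp [hmul h])
    (fun {p} hp => by simpa using summable_norm_prime_pow hp (h2 p hp)) N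
  have hs' : Summable (fun m : N.smoothNumbers => ‖F m‖) := by simpa using hs
  calc ∑ n ∈ u, ‖F n‖ = ∑ n ∈ u with n ∈ N.smoothNumbers, ‖F n‖ := by
        rw [Finset.sum_filter_of_ne]
        intro n hn hne
        have hn0 : n ≠ 0 := fun h => hne (by rw [h, hF0, norm_zero])
        exact Nat.mem_smoothNumbers_of_lt (Nat.pos_of_ne_zero hn0) (hN n hn)
    _ = ∑ m ∈ u.subtype (· ∈ N.smoothNumbers), ‖F m‖ :=
        (Finset.sum_subtype_eq_sum_filter _).symm
    _ ≤ ∑' m : N.smoothNumbers, ‖F m‖ := hs'.sum_le_tsum _ fun _ _ => norm_nonneg _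
    _ = ∏ p ∈ N.primesBelow, ∑' e : ℕ, ‖F (p ^ e)‖ := hsum.tsum_eq
    _ ≤ ∏ p ∈ N.primesBelow, Real.exp (3 * B / (p : ℝ) ^ 2) := by
        refine Finset.prod_le_prod (fun _ _ => tsum_nonneg fun _ => norm_nonneg _) fun p hp => ?_
        have hp' := Nat.prime_of_mem_primesBelow hp
        refine (tsum_norm_prime_pow_le hB hp' hF1 (h1 p hp') (h2 p hp')).trans ?_
        linarith [Real.add_one_le_exp (3 * B / (p : ℝ) ^ 2)]
    _ ≤ _ := by
        rw [← Real.exp_sum, Real.exp_le_exp]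
        exact hb.sum_le_tsum _ fun _ _ => by positivity

/-! ### Dividing out powers of ζ -/

section MoebiusPow

variable {f : ArithmeticFunction ℝ} {p : ℕ}

/-- Möbius inversion along the powers of p: the divisor sum over p^i is a telescoping range sum. -/
lemma moebius_mul_apply_prime_pow_succ (f : ArithmeticFunction ℝ) (hp : p.Prime) (e : ℕ) :
    ((μ : ArithmeticFunction ℝ) * f) (p ^ (e + 1)) = f (p ^ (e + 1)) - f (p ^ e) := by
  have h : ∀ i : ℕ, f (p ^ i) =
      ∑ l ∈ Finset.range (i + 1), ((μ : ArithmeticFunction ℝ) * f) (p ^ l) := fun i => by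
    rw [← Nat.sum_divisors_prime_pow hp, ← ArithmeticFunction.coe_zeta_mul_apply, ← mul_assoc,
      ArithmeticFunction.coe_zeta_mul_coe_moebius, one_mul]
  rw [h (e + 1), h e, Finset.sum_range_succ _ (e + 1)]
  ring

lemma isMultiplicative_moebius_pow_mul (hf : f.IsMultiplicative) (j : ℕ) :
    ((μ : ArithmeticFunction ℝ) ^ j * f).IsMultiplicative :=
  ArithmeticFunction.isMultiplicative_moebius.intCast.pow.mul hf

lemma moebius_pow_mul_apply_prime (hf : f.IsMultiplicative) (hp : p.Prime) (j : ℕ) :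
    ((μ : ArithmeticFunction ℝ) ^ j * f) p = f p - j := by
  induction j with
  | zero => simp
  | succ j ih =>
    have h := moebius_mul_apply_prime_pow_succ ((μ : ArithmeticFunction ℝ) ^ j * f) hp 0
    rw [zero_add, pow_one, pow_zero, ih, (isMultiplicative_moebius_pow_mul hf j).map_one,
      ← mul_assoc, ← pow_succ'] at h
    rw [h]
    push_cast
    ring

lemma norm_moebius_pow_mul_apply_prime_pow_le (hf : f.IsMultiplicative) (hp : p.Prime) {B : ℝ}
    (hB : ∀ e : ℕ, ‖f (p ^ e)‖ ≤ B) (j e : ℕ) :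
    ‖((μ : ArithmeticFunction ℝ) ^ j * f) (p ^ e)‖ ≤ 2 ^ j * B := by
  induction j generalizing e with
  | zero => simpa using hB e
  | succ j ih =>
    have hB1 : 1 ≤ B := by simpa [hf.map_one] using hB 0
    cases e with
    | zero =>
      rw [pow_zero, (isMultiplicative_moebius_pow_mul hf _).map_one, norm_one]
      exact one_le_mul_of_one_le_of_one_le (one_le_pow₀ one_le_two) hB1
    | succ e =>
      rw [pow_succ', mul_assoc, moebius_mul_apply_prime_pow_succ _ hp]
      refine (norm_sub_le _ _).trans ((add_le_add (ih _) (ih _)).trans (le_of_eq ?_))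
      ring

lemma hasSum_moebius_pow_mul_prime_pow (hf : f.IsMultiplicative) (hp : p.Prime) {S : ℝ}
    (hS : HasSum (fun e : ℕ => f (p ^ e) / (p : ℝ) ^ e) S) (j : ℕ) :
    HasSum (fun e : ℕ => ((μ : ArithmeticFunction ℝ) ^ j * f) (p ^ e) / (p : ℝ) ^ e)
      ((1 - 1 / (p : ℝ)) ^ j * S) := by
  induction j with
  | zero => simpa using hS
  | succ j ih =>
    have hp0 : (p : ℝ) ≠ 0 := by exact_mod_cast hp.ne_zero
    have h := ((hasSum_nat_add_iff' 1).2 ih).sub (ih.mul_left (1 / (p : ℝ)))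
    rw [← hasSum_nat_add_iff' 1]
    convert h using 1
    · ext e
      rw [pow_succ', mul_assoc, moebius_mul_apply_prime_pow_succ _ hp, pow_succ (p : ℝ)]
      field_simp
    · simp only [Finset.sum_range_one, pow_zero,
        (isMultiplicative_moebius_pow_mul hf _).map_one]
      ring

end MoebiusPow

/-- With g = μ^(j+1) * f one has g(p) = f(p) − (j + 1) = O(1/p) and g bounded on prime powers, so
g(n)/n is absolutely summable. The constant c is its sum, whose Euler factors are those of f times
(1 − 1/p)^(j+1). -/
theorem exists_hasProd_tendsto_partialSum {f : ArithmeticFunction ℝ} (hf : f.IsMultiplicative)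
    {B : ℝ} (j : ℕ) (h1 : ∀ p : ℕ, p.Prime → ‖f p - (j + 1)‖ ≤ B / p)
    (h2 : ∀ p : ℕ, p.Prime → ∀ e : ℕ, ‖f (p ^ e)‖ ≤ B) {S : Nat.Primes → ℝ}
    (hS : ∀ p : Nat.Primes, HasSum (fun e : ℕ => f (p ^ e) / (p : ℝ) ^ e) (S p)) :
    ∃ c : ℝ, HasProd (fun p : Nat.Primes => (1 - 1 / (p : ℝ)) ^ (j + 1) * S p) c ∧
      Tendsto (fun x : ℝ => partialSum f x / (x * Real.log x ^ j)) atTop (𝓝 (c / j.factorial)) ∧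
      ∃ C : ℝ, 0 ≤ C ∧ ∀ x : ℝ, 1 ≤ x → |partialSum f x| ≤ C * (x * (1 + Real.log x) ^ j) := by
  set g : ArithmeticFunction ℝ := (μ : ArithmeticFunction ℝ) ^ (j + 1) * f with hg
  have hgm : g.IsMultiplicative := isMultiplicative_moebius_pow_mul hf _
  have hfg : f = g * (ζ : ArithmeticFunction ℝ) ^ (j + 1) := by
    rw [hg, mul_right_comm, ← mul_pow, ArithmeticFunction.coe_moebius_mul_coe_zeta, one_pow,
      one_mul]
  have hB : 0 ≤ B := (norm_nonneg _).trans (h2 2 Nat.prime_two 0)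
  have hmul : ∀ {m n : ℕ}, m.Coprime n →
      g (m * n) / ((m * n : ℕ) : ℝ) = g m / m * (g n / n) := fun h => by
    rw [hgm.2 h, Nat.cast_mul, mul_div_mul_comm]
  have h2j : (1 : ℝ) ≤ 2 ^ (j + 1) := one_le_pow₀ one_le_two
  have hsum : Summable fun n : ℕ => ‖g n / n‖ := by
    refine summable_norm_of_multiplicative (B := 2 ^ (j + 1) * B) (by positivity) (by simp)
      (by simp [hgm.map_one]) hmul (fun p hp => ?_) fun p hp e => ?_
    · have hp0 : (0 : ℝ) < p := by exact_mod_cast hp.pos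
      have h := h1 p hp
      rw [hg, moebius_pow_mul_apply_prime hf hp, norm_div, Real.norm_natCast]
      push_cast
      calc _ ≤ B / p / p := by gcongr
        _ ≤ 2 ^ (j + 1) * B / p / p := by gcongr; nlinarith
        _ = _ := by ring
    · rw [norm_div, Real.norm_natCast]
      push_cast
      gcongr
      exact norm_moebius_pow_mul_apply_prime_pow_le hf hp (h2 p hp) _ _
  refine ⟨∑' n : ℕ, g n / n, ?_, ?_, ?_⟩
  · have h := EulerProduct.eulerProduct_hasProd (f := fun n : ℕ => g n / n)
      (by simp [hgm.map_one]) hmul hsum (by simp)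
    refine (congrArg (HasProd · _) (funext fun p => ?_)).mpr h
    rw [← (hasSum_moebius_pow_mul_prime_pow hf p.2 (hS p) (j + 1)).tsum_eq]
    simp [hg]
  · rw [hfg]
    exact tendsto_partialSum_mul_zeta_pow j hsum
  · rw [hfg]
    exact exists_abs_partialSum_mul_zeta_pow_le j hsum

/-! ### Mean values of powers of ω with excluded primes -/

/-- The function `n ↦ a ^ #{p prime : p ∣ n, p ∉ D}`. -/
noncomputable def omegaPow (a : ℝ) (D : Finset ℕ) : ArithmeticFunction ℝ :=
  ⟨fun n => if n = 0 then 0 else a ^ (n.primeFactors \ D).card, by simp⟩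

lemma omegaPow_apply (a : ℝ) (D : Finset ℕ) {n : ℕ} (hn : n ≠ 0) :
    omegaPow a D n = a ^ (n.primeFactors \ D).card := by
  simp [omegaPow, hn]

lemma isMultiplicative_omegaPow (a : ℝ) (D : Finset ℕ) : (omegaPow a D).IsMultiplicative := by
  refine ArithmeticFunction.IsMultiplicative.iff_ne_zero.2 ⟨by simp [omegaPow], ?_⟩
  intro m n hm hn h
  rw [omegaPow_apply _ _ hm, omegaPow_apply _ _ hn, omegaPow_apply _ _ (mul_ne_zero hm hn),
    Nat.primeFactors_mul hm hn, Finset.union_sdiff_distrib, Finset.card_union_of_disjoint, pow_add]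
  exact h.disjoint_primeFactors.mono Finset.sdiff_subset Finset.sdiff_subset

lemma omegaPow_apply_prime_pow_succ (a : ℝ) (D : Finset ℕ) {p : ℕ} (hp : p.Prime) (e : ℕ) :
    omegaPow a D (p ^ (e + 1)) = if p ∈ D then 1 else a := by
  rw [omegaPow_apply _ _ (pow_ne_zero _ hp.ne_zero), Nat.primeFactors_prime_pow e.succ_ne_zero hp]
  split_ifs with h
  · simp [Finset.sdiff_eq_empty_iff_subset.2 (Finset.singleton_subset_iff.2 h)]
  · simp [Finset.sdiff_eq_self_of_disjoint (Finset.disjoint_singleton_left.2 h)]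

lemma omegaPow_apply_prime (a : ℝ) (D : Finset ℕ) {p : ℕ} (hp : p.Prime) :
    omegaPow a D p = if p ∈ D then 1 else a := by
  simpa using omegaPow_apply_prime_pow_succ a D hp 0

lemma hasSum_omegaPow_prime_pow (a : ℝ) (D : Finset ℕ) {p : ℕ} (hp : p.Prime) :
    HasSum (fun e : ℕ => omegaPow a D (p ^ e) / (p : ℝ) ^ e)
      (1 + (if p ∈ D then 1 else a) / ((p : ℝ) - 1)) := by
  have hp1 : (1 : ℝ) < p := by exact_mod_cast hp.one_lt
  have hp0 : (p : ℝ) - 1 ≠ 0 := by linarith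
  have h := (hasSum_geometric_of_lt_one (r := (p : ℝ)⁻¹) (by positivity)
    (inv_lt_one_of_one_lt₀ hp1)).mul_left ((if p ∈ D then 1 else a) / (p : ℝ))
  rw [← hasSum_nat_add_iff' 1]
  have e1 : 1 + (if p ∈ D then 1 else a) / ((p : ℝ) - 1) -
      ∑ i ∈ Finset.range 1, omegaPow a D (p ^ i) / (p : ℝ) ^ i =
      (if p ∈ D then 1 else a) / (p : ℝ) * (1 - (p : ℝ)⁻¹)⁻¹ := by
    have : 1 - (p : ℝ)⁻¹ = (p - 1) / p := by field_simp
    rw [this, Finset.sum_range_one, pow_zero, (isMultiplicative_omegaPow a D).map_one]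
    field_simp
    ring
  rw [e1]
  refine (congrArg (HasSum · _) (funext fun e => ?_)).mpr h
  rw [omegaPow_apply_prime_pow_succ _ _ hp, inv_pow, pow_succ (p : ℝ)]
  field_simp

/-- Gives a growth constant independent of `D`, as domination over all d requires. -/
lemma partialSum_omegaPow_le {a : ℝ} (ha : 1 ≤ a) (D : Finset ℕ) (x : ℝ) :
    |partialSum (omegaPow a D) x| ≤ |partialSum (omegaPow a ∅) x| := by
  have h : ∀ E n, 0 ≤ omegaPow a E n := fun E n => by
    rcases eq_or_ne n 0 with rfl | hn
    · simp
    · rw [omegaPow_apply _ _ hn]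
      positivity
  rw [partialSum, partialSum, abs_of_nonneg (Finset.sum_nonneg fun _ _ => h _ _),
    abs_of_nonneg (Finset.sum_nonneg fun _ _ => h _ _)]
  refine Finset.sum_le_sum fun n hn => ?_
  have hn0 := (Finset.mem_Ioc.1 hn).1.ne'
  rw [omegaPow_apply _ _ hn0, omegaPow_apply _ _ hn0]
  exact pow_le_pow_right₀ ha
    (Finset.card_le_card (Finset.sdiff_subset_sdiff le_rfl (Finset.empty_subset _)))

lemma exists_hasProd_tendsto_partialSum_omegaPow (m : ℕ) (D : Finset ℕ) :
    ∃ c : ℝ, HasProd (fun p : Nat.Primes => (1 - 1 / (p : ℝ)) ^ (m + 1) *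
        (1 + (if (p : ℕ) ∈ D then 1 else (m : ℝ) + 1) / ((p : ℝ) - 1))) c ∧
      Tendsto (fun x : ℝ => partialSum (omegaPow (m + 1) D) x / (x * Real.log x ^ m)) atTop
        (𝓝 (c / m.factorial)) ∧
      ∃ C : ℝ, 0 ≤ C ∧ ∀ x : ℝ, 1 ≤ x →
        |partialSum (omegaPow (m + 1) D) x| ≤ C * (x * (1 + Real.log x) ^ m) := by
  have hm : (0 : ℝ) ≤ m := m.cast_nonneg
  -- Only primes in `D` have value different from m + 1; they are at most M, so the deviation m is
  -- at most mM/p.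
  set M : ℝ := Nat.cast (D.sup id) with hM
  have hM0 : 0 ≤ M := Nat.cast_nonneg _
  refine exists_hasProd_tendsto_partialSum (isMultiplicative_omegaPow _ D)
    (B := (m + 1) * (M + 1)) m (fun p hp => ?_) (fun p hp e => ?_)
    fun p => hasSum_omegaPow_prime_pow _ D p.2
  · have hp0 : (0 : ℝ) < p := by exact_mod_cast hp.pos
    rw [omegaPow_apply_prime _ _ hp, le_div_iff₀ hp0]
    split_ifs with h
    · have hpM : (p : ℝ) ≤ M := Nat.cast_le.2 (Finset.le_sup (f := id) h)
      rw [show (1 : ℝ) - (m + 1) = -m by ring, norm_neg, Real.norm_of_nonneg hm]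
      nlinarith
    · simp
      positivity
  · cases e with
    | zero =>
      rw [pow_zero, (isMultiplicative_omegaPow _ D).map_one, norm_one]
      nlinarith
    | succ e =>
      rw [omegaPow_apply_prime_pow_succ _ _ hp]
      split_ifs
      · rw [norm_one]
        nlinarith
      · rw [Real.norm_of_nonneg (by positivity)]
        nlinarith

lemma hasProd_ite_mem_primes (r : ℕ → ℝ) {D : Finset ℕ} (hD : ∀ p ∈ D, p.Prime) :
    HasProd (fun p : Nat.Primes => if (p : ℕ) ∈ D then r p else 1) (∏ p ∈ D, r p) := by
  have h := hasProd_prod_of_ne_finset_one (f := fun p : Nat.Primes => if (p : ℕ) ∈ D then r p else 1)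
    (s := D.subtype Nat.Prime) (L := SummationFilter.unconditional _)
    (fun p hp => if_neg fun h => hp (Finset.mem_subtype.2 h))
  have e : ∏ p ∈ D.subtype Nat.Prime, (if (p : ℕ) ∈ D then r p else 1) = ∏ p ∈ D, r p := by
    rw [← Finset.prod_subtype_of_mem r hD]
    exact Finset.prod_congr rfl fun p hp => if_pos (Finset.mem_subtype.1 hp)
  rw [← e]
  exact h

/-- The mean value of `omegaPow` in terms of the one with no excluded primes. -/
theorem tendsto_partialSum_omegaPow {m : ℕ} {c : ℝ}
    (hc : HasProd (fun p : Nat.Primes => (1 - 1 / (p : ℝ)) ^ (m + 1) *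
      (1 + ((m : ℝ) + 1) / ((p : ℝ) - 1))) c) {D : Finset ℕ} (hD : ∀ p ∈ D, p.Prime) :
    Tendsto (fun x : ℝ => partialSum (omegaPow (m + 1) D) x / (x * Real.log x ^ m)) atTop
      (𝓝 (c * (∏ p ∈ D, (p : ℝ) / (p + m)) / m.factorial)) := by
  obtain ⟨c', hc', hlim, -⟩ := exists_hasProd_tendsto_partialSum_omegaPow m D
  -- Excluding p changes its local factor from (p + m)/(p − 1) to p/(p − 1), a ratio of p/(p + m).
  have h := hc.mul (hasProd_ite_mem_primes (fun p => (p : ℝ) / (p + m)) hD)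
  suffices e : (fun p : Nat.Primes => (1 - 1 / (p : ℝ)) ^ (m + 1) *
        (1 + (if (p : ℕ) ∈ D then 1 else (m : ℝ) + 1) / ((p : ℝ) - 1))) =
      fun p : Nat.Primes => (1 - 1 / (p : ℝ)) ^ (m + 1) * (1 + ((m : ℝ) + 1) / ((p : ℝ) - 1)) *
        (if (p : ℕ) ∈ D then (p : ℝ) / (p + m) else 1) by
    rw [e] at hc'
    rwa [hc'.unique h] at hlim
  ext p
  have hp1 : (1 : ℝ) < p := by exact_mod_cast p.2.one_lt
  have hp0 : (p : ℝ) - 1 ≠ 0 := by linarith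
  have hpm : (p : ℝ) + m ≠ 0 := by positivity
  split_ifs
  · field_simp
    ring
  · rw [mul_one]

/-! ### The weight that separates the variables -/

/-- The function with `∑ d ∣ n, gcdWeight m d = (m + 1) ^ (-ω n)`. -/
noncomputable def gcdWeight (m : ℕ) : ArithmeticFunction ℝ :=
  (μ : ArithmeticFunction ℝ) * omegaPow (1 / ((m : ℝ) + 1)) ∅

lemma isMultiplicative_gcdWeight (m : ℕ) : (gcdWeight m).IsMultiplicative :=
  ArithmeticFunction.isMultiplicative_moebius.intCast.mul (isMultiplicative_omegaPow _ _)

lemma gcdWeight_apply_prime (m : ℕ) {p : ℕ} (hp : p.Prime) :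
    gcdWeight m p = 1 / ((m : ℝ) + 1) - 1 := by
  have h := moebius_mul_apply_prime_pow_succ (omegaPow (1 / ((m : ℝ) + 1)) ∅) hp 0
  rw [zero_add, pow_one, pow_zero, (isMultiplicative_omegaPow _ _).map_one,
    omegaPow_apply_prime _ _ hp] at h
  rw [gcdWeight, h, if_neg (Finset.notMem_empty p)]

lemma gcdWeight_apply_prime_pow (m : ℕ) {p : ℕ} (hp : p.Prime) (e : ℕ) :
    gcdWeight m (p ^ (e + 2)) = 0 := by
  rw [gcdWeight, moebius_mul_apply_prime_pow_succ _ hp, omegaPow_apply_prime_pow_succ _ _ hp,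
    omegaPow_apply_prime_pow_succ _ _ hp, sub_self]

lemma sum_divisors_gcdWeight (m n : ℕ) :
    ∑ d ∈ n.divisors, gcdWeight m d = omegaPow (1 / ((m : ℝ) + 1)) ∅ n := by
  rw [← ArithmeticFunction.coe_zeta_mul_apply, gcdWeight, ← mul_assoc,
    ArithmeticFunction.coe_zeta_mul_coe_moebius, one_mul]

/-- The weight vanishes at p^e for e ≥ 2, so each Euler factor has two terms. The choice w = m + 1
serves as the dominating series, w(p) = (m + 1)p/(p + m) as the limit. -/
theorem summable_and_hasProd_gcdWeight (m : ℕ) {w : ℕ → ℝ}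
    (hw : ∀ p : ℕ, p.Prime → ‖w p‖ ≤ m + 1) :
    (Summable fun d : ℕ => ‖gcdWeight m d * ((∏ p ∈ d.primeFactors, w p) / d) ^ 2‖) ∧
      HasProd (fun p : Nat.Primes => 1 + (1 / ((m : ℝ) + 1) - 1) * (w p / p) ^ 2)
        (∑' d : ℕ, gcdWeight m d * ((∏ p ∈ d.primeFactors, w p) / d) ^ 2) := by
  have hm : (0 : ℝ) ≤ m := m.cast_nonneg
  set G : ℕ → ℝ := fun d => gcdWeight m d * ((∏ p ∈ d.primeFactors, w p) / d) ^ 2 with hG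
  have hG1 : G 1 = 1 := by simp [hG, (isMultiplicative_gcdWeight m).map_one]
  have hG0 : G 0 = 0 := by simp [hG]
  have hmul : ∀ {a b : ℕ}, a.Coprime b → G (a * b) = G a * G b := by
    intro a b hab
    simp only [hG]
    rw [(isMultiplicative_gcdWeight m).2 hab, hab.primeFactors_mul,
      Finset.prod_union hab.disjoint_primeFactors]
    push_cast
    ring
  have hGp : ∀ p : ℕ, p.Prime → G p = (1 / ((m : ℝ) + 1) - 1) * (w p / p) ^ 2 := fun p hp => by
    simp [hG, gcdWeight_apply_prime m hp, hp.primeFactors]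
  have hGpp : ∀ p : ℕ, p.Prime → ∀ e : ℕ, G (p ^ (e + 2)) = 0 := fun p hp e => by
    simp [hG, gcdWeight_apply_prime_pow m hp e]
  have hs : Summable fun d => ‖G d‖ := by
    refine summable_norm_of_multiplicative (B := ((m : ℝ) + 1) ^ 2) (by positivity) hG0 hG1 hmul
      (fun p hp => ?_) fun p hp e => ?_
    · have h1 : ‖1 / ((m : ℝ) + 1) - 1‖ ≤ 1 := by
        have h0 : 0 ≤ 1 / ((m : ℝ) + 1) := by positivity
        have h1 : 1 / ((m : ℝ) + 1) ≤ 1 := div_le_one_of_le₀ (by linarith) (by positivity)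
        rw [Real.norm_eq_abs, abs_le]
        constructor <;> linarith
      rw [hGp p hp, norm_mul, norm_pow, norm_div, Real.norm_natCast, div_pow]
      have h2 : ‖w p‖ ^ 2 / (p : ℝ) ^ 2 ≤ (m + 1) ^ 2 / (p : ℝ) ^ 2 := by
        gcongr
        exact hw p hp
      calc _ ≤ 1 * (‖w p‖ ^ 2 / (p : ℝ) ^ 2) := by gcongr
        _ ≤ _ := by rwa [one_mul]
    · rw [hGpp p hp, norm_zero]
      positivity
  refine ⟨hs, ?_⟩
  have h := EulerProduct.eulerProduct_hasProd hG1 hmul hs hG0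
  refine (congrArg (HasProd · _) (funext fun p => ?_)).mpr h
  rw [tsum_eq_sum (s := Finset.range 2), Finset.sum_range_succ, Finset.sum_range_one, pow_zero,
    pow_one, hG1, hGp p p.2]
  intro e he
  obtain ⟨e, rfl⟩ := Nat.exists_eq_add_of_le' (not_lt.1 (mt Finset.mem_range.2 he))
  exact hGpp p p.2 e

/-! ### The double sum as a series over common divisors -/

/-- The sum of `(m + 1) ^ ω n` over the multiples `n ≤ x` of `d`, see `sum_multiples_eq`. -/
noncomputable def multiplesSum (m d : ℕ) (x : ℝ) : ℝ :=
  ((m : ℝ) + 1) ^ d.primeFactors.card * partialSum (omegaPow (m + 1) d.primeFactors) (x / d)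

lemma cardDistinctFactors_eq_card_primeFactors (n : ℕ) :
    ArithmeticFunction.cardDistinctFactors n = n.primeFactors.card := by
  rw [ArithmeticFunction.cardDistinctFactors_apply, Nat.primeFactors, List.card_toFinset]

/-- Substitute n = dn': ω(dn') is ω(d) plus the number of primes dividing n' but not d. -/
lemma sum_multiples_eq (m : ℕ) {d : ℕ} (hd : 0 < d) (x : ℝ) :
    ∑ n ∈ Finset.Icc 1 ⌊x⌋₊ with d ∣ n, ((m : ℝ) + 1) ^ n.primeFactors.card =
      multiplesSum m d x := by
  rw [multiplesSum, partialSum, Finset.mul_sum, Nat.floor_div_natCast]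
  symm
  refine Finset.sum_bij' (fun n _ => d * n) (fun n _ => n / d) ?_ ?_ ?_ ?_ ?_
  · intro n hn
    obtain ⟨h0, h1⟩ := Finset.mem_Ioc.1 hn
    rw [Finset.mem_filter, Finset.mem_Icc]
    exact ⟨⟨Nat.mul_pos hd h0, (Nat.mul_comm d n).le.trans ((Nat.le_div_iff_mul_le hd).1 h1)⟩,
      dvd_mul_right _ _⟩
  · intro n hn
    obtain ⟨h, hdn⟩ := Finset.mem_filter.1 hn
    obtain ⟨h0, h1⟩ := Finset.mem_Icc.1 h
    exact Finset.mem_Ioc.2 ⟨Nat.div_pos (Nat.le_of_dvd h0 hdn) hd, Nat.div_le_div_right h1⟩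
  · intro n _
    exact Nat.mul_div_cancel_left n hd
  · intro n hn
    exact Nat.mul_div_cancel' (Finset.mem_filter.1 hn).2
  · intro n hn
    have hn0 := (Finset.mem_Ioc.1 hn).1.ne'
    rw [omegaPow_apply _ _ hn0, ← pow_add, Nat.primeFactors_mul hd.ne' hn0,
      ← Finset.union_sdiff_self_eq_union, Finset.card_union_of_disjoint Finset.disjoint_sdiff]

lemma pow_card_primeFactors_mul (m : ℕ) {a b : ℕ} (ha : a ≠ 0) (hb : b ≠ 0) :
    ((m : ℝ) + 1) ^ (a * b).primeFactors.card =
      (∑ d ∈ (a.gcd b).divisors, gcdWeight m d) *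
        (((m : ℝ) + 1) ^ a.primeFactors.card * ((m : ℝ) + 1) ^ b.primeFactors.card) := by
  have hm : (m : ℝ) + 1 ≠ 0 := by positivity
  rw [sum_divisors_gcdWeight, omegaPow_apply _ _ (Nat.gcd_ne_zero_left ha), Finset.sdiff_empty,
    Nat.primeFactors_gcd ha hb, Nat.primeFactors_mul ha hb, ← pow_add,
    ← Finset.card_union_add_card_inter, pow_add, one_div, inv_pow]
  field_simp

lemma multiplesSum_eq_zero (m : ℕ) {d : ℕ} {x : ℝ} (h : d ∉ Finset.Icc 1 ⌊x⌋₊) :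
    multiplesSum m d x = 0 := by
  rw [multiplesSum, partialSum_of_lt_one, mul_zero]
  rcases Nat.eq_zero_or_pos d with rfl | hd
  · simp
  · have h' : ⌊x⌋₊ < d := by
      by_contra h'
      exact h (Finset.mem_Icc.2 ⟨hd, not_lt.1 h'⟩)
    exact (div_lt_one (by exact_mod_cast hd)).2 ((Nat.floor_lt' hd.ne').1 h')

theorem sum_sum_pow_eq_tsum (m : ℕ) (x y : ℝ) :
    ∑ a ∈ Finset.Icc 1 ⌊x⌋₊, ∑ b ∈ Finset.Icc 1 ⌊y⌋₊, ((m : ℝ) + 1) ^ (a * b).primeFactors.card =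
      ∑' d : ℕ, gcdWeight m d * (multiplesSum m d x * multiplesSum m d y) := by
  rw [tsum_eq_sum (s := Finset.Icc 1 ⌊x⌋₊) fun d hd => by
    rw [multiplesSum_eq_zero m hd, zero_mul, mul_zero]]
  have h1 : ∀ a ∈ Finset.Icc 1 ⌊x⌋₊, ∀ b ∈ Finset.Icc 1 ⌊y⌋₊,
      ((m : ℝ) + 1) ^ (a * b).primeFactors.card = ∑ d ∈ Finset.Icc 1 ⌊x⌋₊, gcdWeight m d *
        ((if d ∣ a then ((m : ℝ) + 1) ^ a.primeFactors.card else 0) *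
          (if d ∣ b then ((m : ℝ) + 1) ^ b.primeFactors.card else 0)) := by
    intro a ha b hb
    obtain ⟨ha0, hax⟩ := Finset.mem_Icc.1 ha
    obtain ⟨hb0, -⟩ := Finset.mem_Icc.1 hb
    have e : (a.gcd b).divisors = {d ∈ Finset.Icc 1 ⌊x⌋₊ | d ∣ a ∧ d ∣ b} := by
      ext d
      rw [Nat.mem_divisors, Nat.dvd_gcd_iff, Finset.mem_filter, Finset.mem_Icc]
      refine ⟨fun h => ⟨⟨Nat.pos_of_dvd_of_pos h.1.1 ha0, (Nat.le_of_dvd ha0 h.1.1).trans hax⟩,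
        h.1⟩, fun h => ⟨h.2, Nat.gcd_ne_zero_left (by omega)⟩⟩
    rw [pow_card_primeFactors_mul m (by omega) (by omega), e, Finset.sum_filter, Finset.sum_mul]
    refine Finset.sum_congr rfl fun d _ => ?_
    by_cases h : d ∣ a <;> by_cases h' : d ∣ b <;> simp [h, h']
  rw [Finset.sum_congr rfl fun a ha => Finset.sum_congr rfl (h1 a ha)]
  simp only [Finset.sum_comm (s := Finset.Icc 1 ⌊y⌋₊)]
  rw [Finset.sum_comm]
  refine Finset.sum_congr rfl fun d hd => ?_
  have hd0 := (Finset.mem_Icc.1 hd).1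
  simp only [← Finset.mul_sum, ← Finset.sum_mul]
  rw [← Finset.sum_filter, ← Finset.sum_filter, sum_multiples_eq m hd0, sum_multiples_eq m hd0]

/-! ### Passage to the limit and the Euler product -/

lemma tendsto_multiplesSum {m : ℕ} {c : ℝ}
    (hc : HasProd (fun p : Nat.Primes => (1 - 1 / (p : ℝ)) ^ (m + 1) *
      (1 + ((m : ℝ) + 1) / ((p : ℝ) - 1))) c) (d : ℕ) :
    Tendsto (fun x : ℝ => multiplesSum m d x / (x * Real.log x ^ m)) atTop
      (𝓝 (c / m.factorial *
        ((∏ p ∈ d.primeFactors, ((m : ℝ) + 1) * (p / (p + m))) / d))) := by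
  have h := (tendsto_partialSum_div_natCast (tendsto_partialSum_omegaPow hc
    (D := d.primeFactors) fun p => Nat.prime_of_mem_primeFactors) d).const_mul
      (((m : ℝ) + 1) ^ d.primeFactors.card)
  rw [Finset.prod_mul_distrib, Finset.prod_const]
  convert h using 1
  · ext x
    rw [multiplesSum, mul_div_assoc]
  · congr 1
    ring

lemma exists_norm_multiplesSum_div_le (m : ℕ) :
    ∃ C : ℝ, 0 ≤ C ∧ ∀ᶠ x : ℝ in atTop, ∀ d : ℕ,
      ‖multiplesSum m d x / (x * Real.log x ^ m)‖ ≤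
        C * ((∏ _p ∈ d.primeFactors, ((m : ℝ) + 1)) / d) := by
  obtain ⟨-, -, -, C, hC, h⟩ := exists_hasProd_tendsto_partialSum_omegaPow m ∅
  refine ⟨C * 2 ^ m, by positivity, ?_⟩
  filter_upwards [eventually_ge_atTop (1 : ℝ),
    Real.tendsto_log_atTop.eventually_ge_atTop 1] with x hx hl d
  have hb := abs_partialSum_div_le (f := omegaPow (m + 1) d.primeFactors) hC
    (fun u hu => (partialSum_omegaPow_le (by simp) _ u).trans (h u hu)) hx d
  rw [norm_div, Real.norm_of_nonneg (by positivity : 0 ≤ x * Real.log x ^ m),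
    div_le_iff₀ (by positivity), multiplesSum, norm_mul,
    Real.norm_of_nonneg (by positivity : 0 ≤ ((m : ℝ) + 1) ^ d.primeFactors.card),
    Finset.prod_const]
  calc _ ≤ ((m : ℝ) + 1) ^ d.primeFactors.card * (C * (x / d * (1 + Real.log x) ^ m)) := by
        gcongr
        exact hb
    _ ≤ ((m : ℝ) + 1) ^ d.primeFactors.card * (C * (x / d * (2 * Real.log x) ^ m)) := by
        gcongr
        linarith
    _ = _ := by ring

theorem tendsto_tsum_gcdWeight {m : ℕ} {c : ℝ}
    (hc : HasProd (fun p : Nat.Primes => (1 - 1 / (p : ℝ)) ^ (m + 1) *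
      (1 + ((m : ℝ) + 1) / ((p : ℝ) - 1))) c) :
    Tendsto (fun z : ℝ × ℝ => ∑' d : ℕ, gcdWeight m d *
        (multiplesSum m d z.1 / (z.1 * Real.log z.1 ^ m) *
          (multiplesSum m d z.2 / (z.2 * Real.log z.2 ^ m)))) (atTop ×ˢ atTop)
      (𝓝 (∑' d : ℕ, gcdWeight m d * (c / m.factorial *
        ((∏ p ∈ d.primeFactors, ((m : ℝ) + 1) * (p / (p + m))) / d)) ^ 2)) := by
  obtain ⟨C, hC, hb⟩ := exists_norm_multiplesSum_div_le m
  have hs := (summable_and_hasProd_gcdWeight m (w := fun _ => (m : ℝ) + 1)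
    fun p _ => (Real.norm_of_nonneg (by positivity)).le).1
  refine tendsto_tsum_of_dominated_convergence (hs.mul_right (C ^ 2)) (fun d => ?_) ?_
  · have h := tendsto_multiplesSum hc d
    rw [sq]
    exact ((h.comp tendsto_fst).mul (h.comp tendsto_snd)).const_mul _
  · filter_upwards [hb.prod_mk hb] with z hz d
    rw [norm_mul, norm_mul, norm_mul, mul_assoc]
    refine mul_le_mul_of_nonneg_left ?_ (norm_nonneg _)
    have hp : 0 ≤ (∏ _p ∈ d.primeFactors, ((m : ℝ) + 1)) / d := by positivity
    rw [Real.norm_of_nonneg (pow_nonneg hp 2)]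
    calc _ ≤ _ := mul_le_mul (hz.1 d) (hz.2 d) (norm_nonneg _) (by positivity)
      _ = _ := by ring

theorem hasProd_sq_mul_tsum_gcdWeight {m : ℕ} {c : ℝ}
    (hc : HasProd (fun p : Nat.Primes => (1 - 1 / (p : ℝ)) ^ (m + 1) *
      (1 + ((m : ℝ) + 1) / ((p : ℝ) - 1))) c) :
    HasProd (fun p : Nat.Primes => (1 - 1 / (p : ℝ)) ^ (2 * m) *
        (1 + 2 * (m : ℝ) / p + -(m : ℝ) / (p : ℝ) ^ 2))
      (c ^ 2 * ∑' d : ℕ, gcdWeight m d *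
        ((∏ p ∈ d.primeFactors, ((m : ℝ) + 1) * (p / (p + m))) / d) ^ 2) := by
  have hw : ∀ p : ℕ, p.Prime → ‖((m : ℝ) + 1) * (p / (p + m))‖ ≤ m + 1 := fun p hp => by
    have hp0 : (0 : ℝ) < p := by exact_mod_cast hp.pos
    rw [Real.norm_of_nonneg (by positivity)]
    refine mul_le_of_le_one_right (by positivity) (div_le_one_of_le₀ ?_ (by positivity))
    linarith [m.cast_nonneg (α := ℝ)]
  rw [sq]
  refine (congrArg (HasProd · _) (funext fun p => ?_)).mpr
    ((hc.mul hc).mul (summable_and_hasProd_gcdWeight m hw).2)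
  have hp1 : (1 : ℝ) < p := by exact_mod_cast p.2.one_lt
  have hp0 : (p : ℝ) - 1 ≠ 0 := by linarith
  have hpm : (p : ℝ) + m ≠ 0 := by positivity
  have e : 1 - 1 / (p : ℝ) = (p - 1) / p := by field_simp
  have e2 : ((1 - 1 / (p : ℝ)) ^ (m + 1)) * ((1 - 1 / (p : ℝ)) ^ (m + 1)) =
      (1 - 1 / (p : ℝ)) ^ (2 * m) * (1 - 1 / (p : ℝ)) ^ 2 := by ring
  -- After cancelling (1 − 1/p)^(2m), the remaining factor is ((p + m)² − m(m + 1))/p² = (p² + 2mp −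
  -- m)/p².
  rw [mul_mul_mul_comm, e2, mul_assoc, mul_assoc]
  congr 1
  rw [e]
  field_simp
  ring

theorem mainTheorem9 (k : ℕ) (hk : 1 ≤ k) :
    Multipliable (fun p : Nat.Primes =>
      (1 - 1 / (p : ℝ)) ^ (2 * (k - 1)) *
        (1 + 2 * ((k : ℝ) - 1) / (p : ℝ) + (1 - (k : ℝ)) / (p : ℝ) ^ 2)) ∧
    Tendsto
      (fun z : ℝ × ℝ =>
        1 / (z.1 * z.2 * (Real.log z.1 * Real.log z.2) ^ (k - 1)) *
          ∑ n₁ ∈ Finset.Icc 1 ⌊z.1⌋₊, ∑ n₂ ∈ Finset.Icc 1 ⌊z.2⌋₊,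
            (k : ℝ) ^ (ArithmeticFunction.cardDistinctFactors (n₁ * n₂)))
      (atTop ×ˢ atTop)
      (𝓝 (1 / ((Nat.factorial (k - 1) : ℝ) ^ 2) *
        ∏' p : Nat.Primes,
          ((1 - 1 / (p : ℝ)) ^ (2 * (k - 1)) *
            (1 + 2 * ((k : ℝ) - 1) / (p : ℝ) + (1 - (k : ℝ)) / (p : ℝ) ^ 2)))) := by
  obtain ⟨m, rfl⟩ := Nat.exists_eq_add_of_le' hk
  obtain ⟨c, hc, -, -⟩ := exists_hasProd_tendsto_partialSum_omegaPow m ∅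
  simp only [Finset.notMem_empty, if_false] at hc
  have hprod := hasProd_sq_mul_tsum_gcdWeight hc
  have e1 : ((m + 1 : ℕ) : ℝ) - 1 = m := by push_cast; ring
  have e2 : 1 - ((m + 1 : ℕ) : ℝ) = -m := by push_cast; ring
  rw [Nat.add_sub_cancel, e1, e2]
  refine ⟨hprod.multipliable, ?_⟩
  rw [hprod.tprod_eq]
  have e3 : 1 / (m.factorial : ℝ) ^ 2 * (c ^ 2 * ∑' d : ℕ, gcdWeight m d *
        ((∏ p ∈ d.primeFactors, ((m : ℝ) + 1) * (p / (p + m))) / d) ^ 2) =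
      ∑' d : ℕ, gcdWeight m d * (c / m.factorial *
        ((∏ p ∈ d.primeFactors, ((m : ℝ) + 1) * (p / (p + m))) / d)) ^ 2 := by
    rw [← tsum_mul_left, ← tsum_mul_left]
    exact tsum_congr fun d => by ring
  rw [e3]
  refine (tendsto_tsum_gcdWeight hc).congr fun z => ?_
  simp only [cardDistinctFactors_eq_card_primeFactors, Nat.cast_add, Nat.cast_one]
  rw [sum_sum_pow_eq_tsum, ← tsum_mul_left]
  exact tsum_congr fun d => by ring
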